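/- Let $n,p$ be integers with $1<p<n$. For a symmetric real $n\times n$ matrix $A$ with eigenvalues $\lambda_1,\dots,\lambda_n$ (counted with multiplicity) put $$\mathcal M_p(A)=\prod_{1\le i_1<\dots<i_p\le n}(\lambda_{i_1}+\dots+\lambda_{i_p}),$$ and let $P_p$ be the cone of those symmetric $A$ for which $\lambda_{i_1}+\dots+\lambda_{i_p}>0$ for all $1\le i_1<\dots<i_p\le n$. A $C^2$ function $u:\mathbb R^n\to\mathbb R$ is called $p$-plurisubharmonic if $D^2u(x)\in\overline{P_p}$ for every $x\in\mathbb R^n$ (closure in the space of symmetric matrices), and $\mathcal M_p(u)(x):=\mathcal M_p(D^2u(x))$. **Corollary.** Let $u\in C^3(\mathbb R^n)$ be a $p$-plurisubharmonic solution of $\mathcal M_p(u)=0$ on all of $\mathbb R^n$. If $u$ is bounded, or more generally if $u(x)=o(|x|)$ as $|x|\to\infty$, then $u$ is constant. -/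

import Mathlib

open Asymptotics

noncomputable section

namespace PPsh

variable {n : ℕ}

/-- The Hessian matrix `D²u(x)`, with entries the second partial derivatives of `u` at `x`. -/
def hessian (u : EuclideanSpace ℝ (Fin n) → ℝ) (x : EuclideanSpace ℝ (Fin n)) :
    Matrix (Fin n) (Fin n) ℝ :=
  Matrix.of fun i j =>
    fderiv ℝ (fderiv ℝ u) x (EuclideanSpace.single i 1) (EuclideanSpace.single j 1)

theorem hessian_isHermitian {u : EuclideanSpace ℝ (Fin n) → ℝ} (hu : ContDiff ℝ 2 u)
    (x : EuclideanSpace ℝ (Fin n)) : (hessian u x).IsHermitian := by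
  have h : IsSymmSndFDerivAt ℝ u x := hu.contDiffAt.isSymmSndFDerivAt (by simp)
  ext i j
  simpa [hessian] using h.eq _ _

/-- The cone `P_p` of symmetric matrices all of whose sums of `p` eigenvalues are positive.
Eigenvalues are counted with multiplicity and indexed by `Fin n`; the `p`-element sets of indices
stand for the increasing `p`-tuples `i₁ < ⋯ < i_p`. -/
def pConvexCone (n p : ℕ) : Set (Matrix (Fin n) (Fin n) ℝ) :=
  {A | ∃ hA : A.IsHermitian,
    ∀ I ∈ (Finset.univ : Finset (Fin n)).powersetCard p, 0 < ∑ i ∈ I, hA.eigenvalues i}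

/-- `u` is a `p`-plurisubharmonic function on `ℝⁿ`: it is `C²` and its Hessian lies everywhere in
the closure of `P_p`. (The symmetric matrices are closed in the space of all matrices, so the
closure can be taken there.) -/
def IsPPlurisubharmonic (p : ℕ) (u : EuclideanSpace ℝ (Fin n) → ℝ) : Prop :=
  ContDiff ℝ 2 u ∧ ∀ x, hessian u x ∈ closure (pConvexCone n p)

/-- The operator `M_p(u)(x) = ∏_{i₁ < ⋯ < i_p} (λ_{i₁} + ⋯ + λ_{i_p})` for a `C²` function `u`,
with `λ_i` the eigenvalues of `D²u(x)`. -/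
def pMongeAmpere (p : ℕ) (u : EuclideanSpace ℝ (Fin n) → ℝ) (hu : ContDiff ℝ 2 u)
    (x : EuclideanSpace ℝ (Fin n)) : ℝ :=
  ∏ I ∈ (Finset.univ : Finset (Fin n)).powersetCard p,
    ∑ i ∈ I, (hessian_isHermitian hu x).eigenvalues i

end PPsh

end

open Filter Topology
open scoped RealInnerProductSpace Matrix

namespace PPsh

/-! Bernstein's method gives |Du(y)| ≤ C(p) M/R whenever |u| ≤ M on the ball of radius R about y.
Since u = o(|x|), M/R can be made arbitrarily small, so Du = 0. For the bound (`norm_fderiv_sq_le`),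
maximise η²|Du|² exp(k(u+2M)²) with η = R² - |z-y|², and diagonalise D²u at the maximum point x. As
M_p(u) = 0, some p eigenvalues, indexed by I, sum to zero and the others are nonnegative
(`exists_eigenbasis`). By Ky Fan, the sum over I of the second derivatives in these frozen
directions is nonnegative everywhere; it vanishes at x, so its gradient does too. This replaces
differentiating the equation and removes the third derivatives. Gradient components off I are
controlled by the first-order condition, those in I by the second-order conditions summed over I
(`cutoff_sq_mul_sum_sq_le`). -/

/-! ### Spectral linear algebra and Ky Fan's inequality. -/

theorem dotProduct_mulVec_eq_sum_eigenvalues {n : ℕ} {A : Matrix (Fin n) (Fin n) ℝ}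
    (hA : A.IsHermitian) (v w : EuclideanSpace ℝ (Fin n)) :
    v.ofLp ⬝ᵥ (A *ᵥ w.ofLp) =
      ∑ k, hA.eigenvalues k * (⟪hA.eigenvectorBasis k, v⟫ * ⟪hA.eigenvectorBasis k, w⟫) := by
  have key : ∀ x y : EuclideanSpace ℝ (Fin n), x.ofLp ⬝ᵥ y.ofLp = ⟪x, y⟫ := fun x y => by
    rw [EuclideanSpace.inner_eq_star_dotProduct, star_trivial, dotProduct_comm]
  have h1 := key v (WithLp.toLp 2 (A *ᵥ w.ofLp))
  rw [h1, ← hA.eigenvectorBasis.sum_inner_mul_inner]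
  refine Finset.sum_congr rfl fun k _ => ?_
  have hT : Aᵀ = A := by simpa [Matrix.IsHermitian] using hA
  have h2 : ⟪hA.eigenvectorBasis k, WithLp.toLp 2 (A *ᵥ w.ofLp)⟫ =
      hA.eigenvalues k * ⟪hA.eigenvectorBasis k, w⟫ := by
    rw [← key, ← key, Matrix.dotProduct_mulVec, ← Matrix.mulVec_transpose, hT,
      hA.mulVec_eigenvectorBasis, smul_dotProduct, smul_eq_mul]
  rw [h2, real_inner_comm]
  ring

theorem dotProduct_mulVec_eigenvectorBasis {n : ℕ} {A : Matrix (Fin n) (Fin n) ℝ}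
    (hA : A.IsHermitian) (i j : Fin n) :
    (hA.eigenvectorBasis i).ofLp ⬝ᵥ (A *ᵥ (hA.eigenvectorBasis j).ofLp) =
      if i = j then hA.eigenvalues i else 0 := by
  rw [dotProduct_mulVec_eq_sum_eigenvalues hA,
    Finset.sum_eq_single i]
  · have h := orthonormal_iff_ite.mp hA.eigenvectorBasis.orthonormal
    rw [h, h]
    split_ifs <;> simp_all
  · intro k _ hk
    have h := orthonormal_iff_ite.mp hA.eigenvectorBasis.orthonormal
    simp [h, hk]
  · simp

/-- If swapping one index never decreases the sum of `l` over `I`, then `l` is larger off `I`. -/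
theorem le_of_isMin_sum {ι : Type*} [DecidableEq ι] {l : ι → ℝ} {I : Finset ι}
    (hI : ∀ J : Finset ι, J.card = I.card → ∑ i ∈ I, l i ≤ ∑ i ∈ J, l i) {i j : ι}
    (hi : i ∈ I) (hj : j ∉ I) : l i ≤ l j := by
  have hj' : j ∉ I.erase i := fun h => hj (Finset.mem_of_mem_erase h)
  have h := hI (insert j (I.erase i)) (by
    rw [Finset.card_insert_of_notMem hj', Finset.card_erase_of_mem hi]
    have := Finset.card_pos.mpr ⟨i, hi⟩
    omega)
  rw [Finset.sum_insert hj', ← Finset.add_sum_erase _ _ hi] at h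
  linarith

/-- Ky Fan: a positive lower bound for the sums of `p` eigenvalues bounds partial traces. -/
theorem sum_dotProduct_mulVec_nonneg {n p : ℕ} (hp : 0 < p) {A : Matrix (Fin n) (Fin n) ℝ}
    (hA : A ∈ pConvexCone n p) (b : OrthonormalBasis (Fin n) ℝ (EuclideanSpace ℝ (Fin n)))
    {I : Finset (Fin n)} (hI : I.card = p) :
    0 ≤ ∑ i ∈ I, (b i).ofLp ⬝ᵥ (A *ᵥ (b i).ofLp) := by
  obtain ⟨hA, hpos⟩ := hA
  set l := hA.eigenvalues
  set e := hA.eigenvectorBasis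
  obtain ⟨J, hJ, hJmin⟩ := Finset.exists_min_image
    ((Finset.univ : Finset (Fin n)).powersetCard p) (fun J => ∑ i ∈ J, l i)
    ⟨I, by simp [Finset.mem_powersetCard, hI]⟩
  have hJc : J.card = p := (Finset.mem_powersetCard.mp hJ).2
  have hmin : ∀ K : Finset (Fin n), K.card = J.card → ∑ i ∈ J, l i ≤ ∑ i ∈ K, l i := fun K hK =>
    hJmin K (by simp [Finset.mem_powersetCard, hK, hJc])
  obtain ⟨m, hm, hmax⟩ := Finset.exists_max_image J l (Finset.card_pos.mp (by omega))
  set s : Fin n → ℝ := fun k => ∑ i ∈ I, ⟪e k, b i⟫ ^ 2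
  have hs0 : ∀ k, 0 ≤ s k := fun k => Finset.sum_nonneg fun i _ => sq_nonneg _
  have hs1 : ∀ k, s k ≤ 1 := fun k => by
    calc s k ≤ ∑ i, ⟪e k, b i⟫ ^ 2 :=
          Finset.sum_le_sum_of_subset_of_nonneg (Finset.subset_univ _) fun _ _ _ => sq_nonneg _
      _ = 1 := by
          have := b.sum_sq_norm_inner_left (e k)
          simpa [e.orthonormal.1 k] using this
  have hsum : ∑ k, s k = p := by
    rw [Finset.sum_comm]
    have : ∀ i ∈ I, ∑ k, ⟪e k, b i⟫ ^ 2 = 1 := fun i _ => by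
      have := e.sum_sq_norm_inner_right (b i)
      simpa [b.orthonormal.1 i] using this
    rw [Finset.sum_congr rfl this]
    simp [hI]
  have htr : ∑ i ∈ I, (b i).ofLp ⬝ᵥ (A *ᵥ (b i).ofLp) = ∑ k, l k * s k := by
    simp_rw [dotProduct_mulVec_eq_sum_eigenvalues hA, s, Finset.mul_sum]
    rw [Finset.sum_comm]
    exact Finset.sum_congr rfl fun k _ => Finset.sum_congr rfl fun i _ => by rw [pow_two]
  -- The weights `s` lie in [0,1] with total p, so the weighted sum is least when they fill J.
  -- Subtracting `l m`, the top eigenvalue in J, makes the factors nonpositive on J and nonnegative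
  -- off it.
  have hcmp : ∑ k ∈ J, (l k - l m) ≤ ∑ k, (l k - l m) * s k := by
    rw [← Finset.sum_add_sum_compl J fun k => (l k - l m) * s k]
    have h1 : ∑ k ∈ J, (l k - l m) ≤ ∑ k ∈ J, (l k - l m) * s k :=
      Finset.sum_le_sum fun k hk => by nlinarith [hmax k hk, hs1 k]
    have h2 : 0 ≤ ∑ k ∈ Jᶜ, (l k - l m) * s k := Finset.sum_nonneg fun k hk =>
      mul_nonneg (sub_nonneg.mpr (le_of_isMin_sum hmin hm (Finset.mem_compl.mp hk))) (hs0 k)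
    linarith
  have hJpos := hpos J hJ
  simp_rw [sub_mul, Finset.sum_sub_distrib, ← Finset.mul_sum, hsum] at hcmp
  rw [Finset.sum_const, hJc, nsmul_eq_mul] at hcmp
  rw [htr]
  change 0 < ∑ i ∈ J, l i at hJpos
  linarith

/-- In a fixed basis the partial trace is linear in the matrix, so its sign passes to the closure
without continuity of eigenvalues. -/
theorem sum_dotProduct_mulVec_nonneg_of_mem_closure {n p : ℕ} (hp : 0 < p)
    {A : Matrix (Fin n) (Fin n) ℝ} (hA : A ∈ closure (pConvexCone n p))
    (b : OrthonormalBasis (Fin n) ℝ (EuclideanSpace ℝ (Fin n)))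
    {I : Finset (Fin n)} (hI : I.card = p) :
    0 ≤ ∑ i ∈ I, (b i).ofLp ⬝ᵥ (A *ᵥ (b i).ofLp) := by
  have hcl : IsClosed {B : Matrix (Fin n) (Fin n) ℝ |
      0 ≤ ∑ i ∈ I, (b i).ofLp ⬝ᵥ (B *ᵥ (b i).ofLp)} :=
    isClosed_le continuous_const (by fun_prop)
  exact closure_minimal (fun B hB => sum_dotProduct_mulVec_nonneg hp hB b hI) hcl hA

theorem sndFDeriv_eq_dotProduct_hessian {n : ℕ} (u : EuclideanSpace ℝ (Fin n) → ℝ)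
    (x v w : EuclideanSpace ℝ (Fin n)) :
    fderiv ℝ (fderiv ℝ u) x v w = v.ofLp ⬝ᵥ (hessian u x *ᵥ w.ofLp) := by
  conv_lhs => rw [← (EuclideanSpace.basisFun (Fin n) ℝ).sum_repr v,
    ← (EuclideanSpace.basisFun (Fin n) ℝ).sum_repr w]
  simp [hessian, dotProduct, Matrix.mulVec, Finset.mul_sum, mul_comm, mul_left_comm]
  exact Finset.sum_comm

/-- At each point, a solution has an orthonormal eigenbasis of the Hessian with `p` eigenvalues of
sum zero, the others being nonnegative; the corresponding `p`-traces are nonnegative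
everywhere. -/
theorem exists_eigenbasis {n p : ℕ} (hp : 0 < p) {u : EuclideanSpace ℝ (Fin n) → ℝ}
    (hu : ContDiff ℝ 2 u) (hpsh : IsPPlurisubharmonic p u) (x : EuclideanSpace ℝ (Fin n))
    (hsol : pMongeAmpere p u hu x = 0) :
    ∃ (b : OrthonormalBasis (Fin n) ℝ (EuclideanSpace ℝ (Fin n))) (l : Fin n → ℝ)
      (I : Finset (Fin n)), I.card = p ∧
      (∀ i j, fderiv ℝ (fderiv ℝ u) x (b i) (b j) = if i = j then l i else 0) ∧
      ∑ i ∈ I, l i = 0 ∧ (∀ j ∉ I, 0 ≤ l j) ∧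
      ∀ y, 0 ≤ ∑ i ∈ I, fderiv ℝ (fderiv ℝ u) y (b i) (b i) := by
  have hA := hessian_isHermitian hu x
  obtain ⟨I, hI, hI0⟩ := Finset.prod_eq_zero_iff.mp hsol
  have hIc : I.card = p := (Finset.mem_powersetCard.mp hI).2
  have hnn : ∀ J : Finset (Fin n), J.card = I.card → ∑ i ∈ I, hA.eigenvalues i ≤
      ∑ i ∈ J, hA.eigenvalues i := fun J hJ => by
    have := sum_dotProduct_mulVec_nonneg_of_mem_closure hp (hpsh.2 x) hA.eigenvectorBasis
      (hJ.trans hIc)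
    rw [hI0]
    simpa [dotProduct_mulVec_eigenvectorBasis hA] using this
  refine ⟨hA.eigenvectorBasis, hA.eigenvalues, I, hIc, fun i j => ?_, hI0, fun j hj => ?_,
    fun y => ?_⟩
  · rw [sndFDeriv_eq_dotProduct_hessian, dotProduct_mulVec_eigenvectorBasis]
  · by_contra! hneg
    have : ∑ i ∈ I, hA.eigenvalues i < 0 := Finset.sum_neg
      (fun i hi => (le_of_isMin_sum hnn hi hj).trans_lt hneg) (Finset.card_pos.mp (by omega))
    linarith
  · simp_rw [sndFDeriv_eq_dotProduct_hessian]
    exact sum_dotProduct_mulVec_nonneg_of_mem_closure hp (hpsh.2 y) _ hIc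

/-! ### Maximum conditions and the algebra drawn from them. -/

/-- Were g'' positive, the point would also be a local minimum, so g would be locally constant and
g'' zero. -/
theorem second_deriv_nonpos_of_isLocalMax {g g' : ℝ → ℝ} {a g'' : ℝ} (hmax : IsLocalMax g a)
    (hg : ∀ᶠ t in 𝓝 a, HasDerivAt g (g' t) t) (hg' : HasDerivAt g' g'' a) : g'' ≤ 0 := by
  by_contra! hpos
  have hd : deriv g =ᶠ[𝓝 a] g' := hg.mono fun t ht => ht.deriv
  have hdd : deriv (deriv g) a = g'' := hd.deriv_eq.trans hg'.deriv
  have hmin : IsLocalMin g a := isLocalMin_of_deriv_deriv_pos (by rwa [hdd])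
    hmax.deriv_eq_zero hg.self_of_nhds.continuousAt
  have hconst : g =ᶠ[𝓝 a] fun _ => g a := by
    filter_upwards [hmax, hmin] with t h1 h2 using le_antisymm h1 h2
  have h0 : deriv g =ᶠ[𝓝 a] fun _ => 0 := by
    filter_upwards [hconst.eventuallyEq_nhds] with t ht
    rw [ht.deriv_eq, deriv_const]
  have : deriv (deriv g) a = 0 := by rw [h0.deriv_eq, deriv_const]
  linarith

/-- First and second order conditions at a local maximum of `2 log N + log W + k (U + s)²`. -/
theorem log_conditions_of_isLocalMax {N N' W W' U U' : ℝ → ℝ} {N₂ W₂ U₂ k s : ℝ}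
    (hN : ∀ t, HasDerivAt N (N' t) t) (hN' : HasDerivAt N' N₂ 0)
    (hW : ∀ t, HasDerivAt W (W' t) t) (hW' : HasDerivAt W' W₂ 0)
    (hU : ∀ t, HasDerivAt U (U' t) t) (hU' : HasDerivAt U' U₂ 0)
    (hN0 : 0 < N 0) (hW0 : 0 < W 0)
    (hmax : IsLocalMax (fun t => N t ^ 2 * W t * Real.exp (k * (U t + s) ^ 2)) 0) :
    2 * (N' 0 / N 0) + W' 0 / W 0 + 2 * k * (U 0 + s) * U' 0 = 0 ∧
    2 * (N₂ / N 0 - (N' 0 / N 0) ^ 2) + (W₂ / W 0 - (W' 0 / W 0) ^ 2) +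
      (2 * k * U' 0 ^ 2 + 2 * k * (U 0 + s) * U₂) ≤ 0 := by
  have eN : ∀ᶠ t in 𝓝 (0 : ℝ), 0 < N t := (hN 0).continuousAt.eventually_const_lt hN0
  have eW : ∀ᶠ t in 𝓝 (0 : ℝ), 0 < W t := (hW 0).continuousAt.eventually_const_lt hW0
  set g : ℝ → ℝ := fun t => 2 * Real.log (N t) + Real.log (W t) + k * (U t + s) ^ 2
  set g' : ℝ → ℝ := fun t => 2 * (N' t / N t) + W' t / W t + 2 * k * (U t + s) * U' t
  have hg : ∀ᶠ t in 𝓝 (0 : ℝ), HasDerivAt g (g' t) t := by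
    filter_upwards [eN, eW] with t h1 h2
    refine ((((hN t).log h1.ne').const_mul 2).add ((hW t).log h2.ne')).add
      ((((hU t).add_const s).pow 2).const_mul k) |>.congr_deriv ?_
    simp only [g']
    push_cast
    ring
  have hgmax : IsLocalMax g 0 := by
    have hlog : ∀ t, 0 < N t → 0 < W t →
        g t = Real.log (N t ^ 2 * W t * Real.exp (k * (U t + s) ^ 2)) := fun t h1 h2 => by
      rw [Real.log_mul (by positivity) (by positivity), Real.log_mul (by positivity) h2.ne',
        Real.log_pow, Real.log_exp]
      norm_num [g]
    filter_upwards [eN, eW, hmax] with t h1 h2 h3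
    rw [hlog t h1 h2, hlog 0 hN0 hW0]
    exact Real.log_le_log (by positivity) h3
  have hg2 := ((((hN'.div (hN 0) hN0.ne').const_mul 2).add (hW'.div (hW 0) hW0.ne')).add
      ((((hU 0).add_const s).const_mul (2 * k)).mul hU'))
  refine ⟨hgmax.hasDerivAt_eq_zero hg.self_of_nhds, ?_⟩
  have h := second_deriv_nonpos_of_isLocalMax hgmax hg hg2
  refine le_trans (le_of_eq ?_) h
  have := hN0.ne'
  have := hW0.ne'
  field_simp

/-- The algebraic core of the gradient estimate. `q i` is the logarithmic derivative of the cutoff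
of value `η`, `a i` the components of the gradient and `c` half the derivative of the weight. -/
theorem cutoff_sq_mul_sum_sq_le {ι : Type*} [Fintype ι] [DecidableEq ι] {I : Finset ι}
    {l a q T : ι → ℝ} {η w c d Q : ℝ} (hη : 0 < η) (hw : 0 < w) (hc : 0 < c) (hd : 0 < d)
    (hcd : 8 * c ^ 2 ≤ d) (hsum : ∑ i, a i ^ 2 = w) (hl0 : ∑ i ∈ I, l i = 0)
    (hl : ∀ j ∉ I, 0 ≤ l j) (hT : ∑ i ∈ I, T i = 0) (hQ : ∑ i, q i ^ 2 ≤ Q)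
    (h1 : ∀ i, 2 * q i + 2 * l i * a i / w + 2 * c * a i = 0)
    (h2 : ∀ i ∈ I, 2 * (-2 / η - q i ^ 2) + ((2 * l i ^ 2 + T i) / w - (2 * l i * a i / w) ^ 2) +
      (2 * d * a i ^ 2 + 2 * c * l i) ≤ 0) :
    w ≤ 2 * Q / c ^ 2 + (8 * I.card / η + 20 * Q) / d := by
  -- Off I, q = -(l/w + c)a with l ≥ 0, hence |q| ≥ c|a|.
  have hoff : ∑ j ∈ Iᶜ, a j ^ 2 ≤ Q / c ^ 2 := by
    rw [le_div_iff₀ (by positivity), Finset.sum_mul]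
    refine le_trans (Finset.sum_le_sum (g := fun j => q j ^ 2) fun j hj => ?_)
      ((Finset.sum_le_sum_of_subset_of_nonneg (Finset.subset_univ _)
        fun _ _ _ => sq_nonneg _).trans hQ)
    have hlj : 0 ≤ l j / w := div_nonneg (hl j (Finset.mem_compl.mp hj)) hw.le
    have : q j = -((l j / w + c) * a j) := by
      have := h1 j
      rw [mul_div_right_comm, mul_div_assoc] at this
      linarith
    rw [this, neg_sq, mul_pow, mul_comm]
    gcongr
    linarith
  have hon : d * ∑ i ∈ I, a i ^ 2 ≤ 4 * I.card / η + 10 * Q := by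
    have hi : ∀ i ∈ I, d * a i ^ 2 ≤ 4 / η + 10 * q i ^ 2 - T i / w - 2 * c * l i := by
      intro i hi
      have e1 : (2 * l i * a i / w) = -(2 * q i + 2 * c * a i) := by linarith [h1 i]
      have e2 := h2 i hi
      rw [e1, add_div] at e2
      have e3 : 0 ≤ 2 * l i ^ 2 / w := by positivity
      have e4 : 2 * (-2 / η - q i ^ 2) = -(4 / η) - 2 * q i ^ 2 := by ring
      rw [e4] at e2
      -- (2q + 2ca)² ≤ 8q² + 8c²a² ≤ 8q² + d a², which absorbs half of the good term 2d a².
      nlinarith [sq_nonneg (q i - c * a i), mul_le_mul_of_nonneg_right hcd (sq_nonneg (a i))]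
    calc d * ∑ i ∈ I, a i ^ 2 = ∑ i ∈ I, d * a i ^ 2 := Finset.mul_sum _ _ _
      _ ≤ ∑ i ∈ I, (4 / η + 10 * q i ^ 2 - T i / w - 2 * c * l i) := Finset.sum_le_sum hi
      _ = 4 * I.card / η + 10 * ∑ i ∈ I, q i ^ 2 := by
          rw [Finset.sum_sub_distrib, Finset.sum_sub_distrib, Finset.sum_add_distrib,
            ← Finset.mul_sum, ← Finset.mul_sum, ← Finset.sum_div, ← Finset.sum_div, hT, hl0,
            Finset.sum_const, nsmul_eq_mul]
          ring
      _ ≤ _ := by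
          gcongr
          exact (Finset.sum_le_sum_of_subset_of_nonneg (Finset.subset_univ _)
            fun _ _ _ => sq_nonneg _).trans hQ
  have hon' : ∑ i ∈ I, a i ^ 2 ≤ (4 * I.card / η + 10 * Q) / d := by
    rwa [le_div_iff₀ hd, mul_comm]
  have hQ0 : 0 ≤ Q := le_trans (Finset.sum_nonneg fun _ _ => sq_nonneg _) hQ
  rw [← hsum, ← Finset.sum_add_sum_compl I]
  have x1 : (8 * I.card / η + 20 * Q) / d = 2 * ((4 * I.card / η + 10 * Q) / d) := by ring
  have x2 : 0 ≤ (4 * I.card / η + 10 * Q) / d := by positivity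
  have x3 : 0 ≤ Q / c ^ 2 := by positivity
  rw [x1, mul_div_assoc]
  linarith

/-! ### Derivatives along lines. -/

theorem norm_sq_eq_sum_apply_sq {ι E : Type*} [Fintype ι] [NormedAddCommGroup E]
    [InnerProductSpace ℝ E] [CompleteSpace E] (b : OrthonormalBasis ι ℝ E) (L : E →L[ℝ] ℝ) :
    ‖L‖ ^ 2 = ∑ i, L (b i) ^ 2 := by
  obtain ⟨v, rfl⟩ := (InnerProductSpace.toDual ℝ E).surjective L
  rw [LinearIsometryEquiv.norm_map, ← b.sum_sq_norm_inner_left]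
  simp

theorem hasDerivAt_comp_line {E F : Type*} [NormedAddCommGroup E] [NormedSpace ℝ E]
    [NormedAddCommGroup F] [NormedSpace ℝ F] {f : E → F} (hf : Differentiable ℝ f) (x e : E)
    (t : ℝ) : HasDerivAt (fun t : ℝ => f (x + t • e)) (fderiv ℝ f (x + t • e) e) t := by
  have h : HasDerivAt (fun t : ℝ => x + t • e) e t := by
    simpa using ((hasDerivAt_id t).smul_const e).const_add x
  exact (hf (x + t • e)).hasFDerivAt.comp_hasDerivAt t h

theorem hasDerivAt_apply_const {E F : Type*} [NormedAddCommGroup E] [NormedSpace ℝ E]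
    [NormedAddCommGroup F] [NormedSpace ℝ F] {L : ℝ → E →L[ℝ] F} {L' : E →L[ℝ] F} {t : ℝ}
    (h : HasDerivAt L L' t) (v : E) : HasDerivAt (fun t => L t v) (L' v) t := by
  simpa using h.clm_apply (hasDerivAt_const t v)

theorem hasDerivAt_cutoff_line {E : Type*} [NormedAddCommGroup E] [InnerProductSpace ℝ E]
    {e : E} (he : ‖e‖ = 1) (x y : E) (R t : ℝ) :
    HasDerivAt (fun t : ℝ => R ^ 2 - ‖x + t • e - y‖ ^ 2) (-2 * (⟪x - y, e⟫ + t)) t := by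
  have h : (fun t : ℝ => R ^ 2 - ‖x + t • e - y‖ ^ 2) =
      fun t => R ^ 2 - (‖x - y‖ ^ 2 + 2 * (t * ⟪x - y, e⟫) + t ^ 2) := by
    ext t
    rw [show x + t • e - y = (x - y) + t • e by abel, norm_add_sq_real, inner_smul_right,
      norm_smul, he, mul_one, Real.norm_eq_abs, sq_abs]
  rw [h]
  have := (((((hasDerivAt_id t).mul_const ⟪x - y, e⟫).const_mul 2).const_add
    (‖x - y‖ ^ 2)).add ((hasDerivAt_id t).pow 2)).const_sub (R ^ 2)
  refine this.congr_deriv ?_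
  simp only [id, Nat.cast_ofNat, one_mul, Nat.add_one_sub_one, pow_one]
  ring

/-- First derivative of the square of a differentiable family of functionals, in coordinates. -/
theorem hasDerivAt_norm_sq_line {ι E : Type*} [Fintype ι] [NormedAddCommGroup E]
    [InnerProductSpace ℝ E] [CompleteSpace E] (b : OrthonormalBasis ι ℝ E)
    {L : ℝ → E →L[ℝ] ℝ} {L' : E →L[ℝ] ℝ} {t : ℝ} (h : HasDerivAt L L' t) :
    HasDerivAt (fun t => ‖L t‖ ^ 2) (∑ j, 2 * (L t (b j) * L' (b j))) t := by
  simp_rw [norm_sq_eq_sum_apply_sq b]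
  refine (HasDerivAt.fun_sum fun j _ => (hasDerivAt_apply_const h (b j)).pow 2).congr_deriv ?_
  exact Finset.sum_congr rfl fun j _ => by
    simp only [Nat.cast_ofNat, Nat.add_one_sub_one, pow_one]
    ring

/-! ### Third derivatives and the conditions at an interior maximum. -/

section

variable {E : Type*} [NormedAddCommGroup E] [InnerProductSpace ℝ E] {u : E → ℝ}

/-- Symmetry of the third derivative under moving the last argument to the front. -/
theorem thirdFDeriv_rotate (hu : ContDiff ℝ 3 u) (x e ξ : E) :
    fderiv ℝ (fderiv ℝ (fderiv ℝ u)) x e e ξ = fderiv ℝ (fderiv ℝ (fderiv ℝ u)) x ξ e e := by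
  have hu1 : ContDiff ℝ 2 (fderiv ℝ u) := hu.fderiv_right (by norm_num)
  have hu2 : Differentiable ℝ (fderiv ℝ (fderiv ℝ u)) :=
    (hu1.fderiv_right (m := 1) (by norm_num)).differentiable (by norm_num)
  have h1 : IsSymmSndFDerivAt ℝ (fderiv ℝ u) x := hu1.contDiffAt.isSymmSndFDerivAt (by simp)
  have h2 : ∀ z, fderiv ℝ (fderiv ℝ u) z e ξ = fderiv ℝ (fderiv ℝ u) z ξ e := fun z =>
    ((hu.of_le (by norm_num) : ContDiff ℝ 2 u).contDiffAt.isSymmSndFDerivAt (by simp)).eq _ _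
  have hd : ∀ v w z : E,
      fderiv ℝ (fun y => fderiv ℝ (fderiv ℝ u) y v w) x z =
        fderiv ℝ (fderiv ℝ (fderiv ℝ u)) x z v w := fun v w z => by
    have := ((hu2 x).hasFDerivAt.clm_apply (hasFDerivAt_const v x)).clm_apply
      (hasFDerivAt_const w x)
    rw [this.fderiv]
    simp
  -- Differentiate the symmetry of D²u, then use the symmetry of the second derivative of Du.
  rw [← hd e ξ e, funext h2, hd ξ e e, h1.eq]

/-- A nonnegative partial trace of the Hessian has vanishing derivative at its zeros. -/
theorem sum_thirdFDeriv_eq_zero (hu : ContDiff ℝ 3 u) {ι : Type*} (I : Finset ι)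
    (b : ι → E) (x : E)
    (hx : ∑ i ∈ I, fderiv ℝ (fderiv ℝ u) x (b i) (b i) = 0)
    (hnn : ∀ y, 0 ≤ ∑ i ∈ I, fderiv ℝ (fderiv ℝ u) y (b i) (b i))
    (ξ : E) :
    ∑ i ∈ I, fderiv ℝ (fderiv ℝ (fderiv ℝ u)) x ξ (b i) (b i) = 0 := by
  have hu1 : ContDiff ℝ 2 (fderiv ℝ u) := hu.fderiv_right (by norm_num)
  have hu2 : Differentiable ℝ (fderiv ℝ (fderiv ℝ u)) :=
    (hu1.fderiv_right (m := 1) (by norm_num)).differentiable (by norm_num)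
  have hmin : IsLocalMin (fun y => ∑ i ∈ I, fderiv ℝ (fderiv ℝ u) y (b i) (b i)) x :=
    Eventually.of_forall fun y => by
      change ∑ i ∈ I, fderiv ℝ (fderiv ℝ u) x (b i) (b i) ≤ _
      rw [hx]
      exact hnn y
  have hd := HasFDerivAt.fun_sum (u := I) fun i _ =>
    ((hu2 x).hasFDerivAt.clm_apply (hasFDerivAt_const (b i) x)).clm_apply
      (hasFDerivAt_const (b i) x)
  have h := congrArg (fun L => L ξ) (hmin.hasFDerivAt_eq_zero hd)
  simpa using h

theorem bernstein_conditions {ι : Type*} [Fintype ι] [DecidableEq ι] [CompleteSpace E]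
    (hu : ContDiff ℝ 3 u)
    {b : OrthonormalBasis ι ℝ E} {l : ι → ℝ}
    {x y : E}
    (hb : ∀ i j, fderiv ℝ (fderiv ℝ u) x (b i) (b j) = if i = j then l i else 0)
    {R k s : ℝ} (hη : 0 < R ^ 2 - ‖x - y‖ ^ 2) (hw : 0 < ‖fderiv ℝ u x‖ ^ 2)
    (hmax : IsLocalMax (fun z => (R ^ 2 - ‖z - y‖ ^ 2) ^ 2 * ‖fderiv ℝ u z‖ ^ 2 *
      Real.exp (k * (u z + s) ^ 2)) x) (i : ι) :
    2 * (-2 * ⟪x - y, b i⟫ / (R ^ 2 - ‖x - y‖ ^ 2)) +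
      2 * l i * fderiv ℝ u x (b i) / ‖fderiv ℝ u x‖ ^ 2 +
      2 * (k * (u x + s)) * fderiv ℝ u x (b i) = 0 ∧
    2 * (-2 / (R ^ 2 - ‖x - y‖ ^ 2) - (-2 * ⟪x - y, b i⟫ / (R ^ 2 - ‖x - y‖ ^ 2)) ^ 2) +
      ((2 * l i ^ 2 + ∑ j, 2 * fderiv ℝ u x (b j) *
          fderiv ℝ (fderiv ℝ (fderiv ℝ u)) x (b i) (b i) (b j)) / ‖fderiv ℝ u x‖ ^ 2 -
        (2 * l i * fderiv ℝ u x (b i) / ‖fderiv ℝ u x‖ ^ 2) ^ 2) +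
      (2 * k * fderiv ℝ u x (b i) ^ 2 + 2 * (k * (u x + s)) * l i) ≤ 0 := by
  have hu0 : Differentiable ℝ u := hu.differentiable (by norm_num)
  have hu1 : ContDiff ℝ 2 (fderiv ℝ u) := hu.fderiv_right (by norm_num)
  have hu1' : Differentiable ℝ (fderiv ℝ u) := hu1.differentiable (by norm_num)
  have hu2 : Differentiable ℝ (fderiv ℝ (fderiv ℝ u)) :=
    (hu1.fderiv_right (m := 1) (by norm_num)).differentiable (by norm_num)
  set e := b i
  have he : ‖e‖ = 1 := b.orthonormal.1 i
  have hN : ∀ t : ℝ, HasDerivAt (fun t : ℝ => R ^ 2 - ‖x + t • e - y‖ ^ 2)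
      (-2 * (⟪x - y, e⟫ + t)) t := hasDerivAt_cutoff_line he x y R
  have hN' : HasDerivAt (fun t : ℝ => -2 * (⟪x - y, e⟫ + t)) (-2) 0 := by
    simpa using (((hasDerivAt_id (0 : ℝ)).const_add ⟪x - y, e⟫).const_mul (-2))
  have hU : ∀ t : ℝ, HasDerivAt (fun t : ℝ => u (x + t • e)) (fderiv ℝ u (x + t • e) e) t :=
    hasDerivAt_comp_line hu0 x e
  have hD : ∀ (v : E) (t : ℝ),
      HasDerivAt (fun t : ℝ => fderiv ℝ u (x + t • e) v)
        (fderiv ℝ (fderiv ℝ u) (x + t • e) e v) t := fun v t =>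
    hasDerivAt_apply_const (hasDerivAt_comp_line hu1' x e t) v
  have hH : HasDerivAt (fun t : ℝ => fderiv ℝ (fderiv ℝ u) (x + t • e))
      (fderiv ℝ (fderiv ℝ (fderiv ℝ u)) x e) 0 := by
    have h := hasDerivAt_comp_line (F := E →L[ℝ] E →L[ℝ] ℝ) hu2 x e 0
    rw [zero_smul, add_zero] at h
    exact h
  have hD' : ∀ v : E,
      HasDerivAt (fun t : ℝ => fderiv ℝ (fderiv ℝ u) (x + t • e) e v)
        (fderiv ℝ (fderiv ℝ (fderiv ℝ u)) x e e v) 0 := fun v =>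
    hasDerivAt_apply_const (hasDerivAt_apply_const hH e) v
  have hW : ∀ t : ℝ, HasDerivAt (fun t : ℝ => ‖fderiv ℝ u (x + t • e)‖ ^ 2)
      (∑ j, 2 * (fderiv ℝ u (x + t • e) (b j) *
        fderiv ℝ (fderiv ℝ u) (x + t • e) e (b j))) t := fun t =>
    hasDerivAt_norm_sq_line b (hasDerivAt_comp_line hu1' x e t)
  have hW' : HasDerivAt _ _ (0 : ℝ) := HasDerivAt.fun_sum (u := Finset.univ) fun j _ =>
    ((hD (b j) 0).mul (hD' (b j))).const_mul 2
  have hline : ContinuousAt (fun t : ℝ => x + t • e) 0 := by fun_prop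
  have hmax' : IsLocalMax (fun t : ℝ => (R ^ 2 - ‖x + t • e - y‖ ^ 2) ^ 2 *
      ‖fderiv ℝ u (x + t • e)‖ ^ 2 * Real.exp (k * (u (x + t • e) + s) ^ 2)) 0 := by
    have h0 : Tendsto (fun t : ℝ => x + t • e) (𝓝 0) (𝓝 x) := by simpa using hline.tendsto
    filter_upwards [h0.eventually hmax] with t ht
    simpa using ht
  have key := log_conditions_of_isLocalMax hN hN' hW hW' hU (hD e 0) (by simpa using hη)
    (by simpa using hw) hmax'
  simp only [zero_smul, add_zero] at key
  have hsum : ∑ j, 2 * (fderiv ℝ u x (b j) * fderiv ℝ (fderiv ℝ u) x e (b j)) =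
      2 * l i * fderiv ℝ u x e := by
    simp_rw [e, hb]
    simp
    ring
  have hsum' : ∑ j, 2 * (fderiv ℝ (fderiv ℝ u) x e (b j) * fderiv ℝ (fderiv ℝ u) x e (b j) +
      fderiv ℝ u x (b j) * fderiv ℝ (fderiv ℝ (fderiv ℝ u)) x e e (b j)) =
      2 * l i ^ 2 + ∑ j, 2 * fderiv ℝ u x (b j) *
          fderiv ℝ (fderiv ℝ (fderiv ℝ u)) x e e (b j) := by
    simp_rw [mul_add, Finset.sum_add_distrib]
    congr 1
    · simp_rw [e, hb]
      simp
      ring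
    · exact Finset.sum_congr rfl fun j _ => by ring
  have hee : fderiv ℝ (fderiv ℝ u) x e e = l i := by simp [e, hb]
  rw [hsum, hsum', hee] at key
  exact ⟨by linarith [key.1], by linarith [key.2]⟩

end

/-! ### The interior gradient estimate and the choice of balls. -/

section

variable {n : ℕ} {u : EuclideanSpace ℝ (Fin n) → ℝ}

/-- Interior gradient estimate for `p`-plurisubharmonic solutions of `M_p(u) = 0`. -/
theorem norm_fderiv_sq_le {p : ℕ} (hp : 0 < p) (hu : ContDiff ℝ 3 u)
    (hpsh : IsPPlurisubharmonic p u)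
    (hsol : ∀ x, pMongeAmpere p u (hu.of_le (by norm_num)) x = 0)
    (y : EuclideanSpace ℝ (Fin n)) {R M : ℝ} (hR : 0 < R) (hM : 0 < M)
    (hbd : ∀ x ∈ Metric.closedBall y R, |u x| ≤ M) :
    ‖fderiv ℝ u y‖ ^ 2 ≤ 3 * (47232 + 576 * p) * (M / R) ^ 2 := by
  have hu1 : ContDiff ℝ 2 (fderiv ℝ u) := hu.fderiv_right (by norm_num)
  -- On the ball u + 2M lies in [M, 3M], so k(u+2M)² ≤ 1/8. With c = k(u+2M) this is exactly 8c² ≤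
  -- k.
  set k : ℝ := 1 / (72 * M ^ 2) with hk
  have hk0 : 0 < k := by positivity
  set Φ : EuclideanSpace ℝ (Fin n) → ℝ := fun z => (R ^ 2 - ‖z - y‖ ^ 2) ^ 2 *
    ‖fderiv ℝ u z‖ ^ 2 * Real.exp (k * (u z + 2 * M) ^ 2) with hΦ
  have hΦc : Continuous Φ := by
    have h1 := hu.continuous
    have h2 := hu1.continuous
    fun_prop
  have hyB : y ∈ Metric.closedBall y R := Metric.mem_closedBall_self hR.le
  obtain ⟨x, hxB, hxmax⟩ := (isCompact_closedBall y R).exists_isMaxOn ⟨y, hyB⟩ hΦc.continuousOn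
  rcases (sq_nonneg ‖fderiv ℝ u y‖).eq_or_lt with h0 | h0
  · rw [← h0]
    positivity
  have hΦy : 0 < Φ y := by
    simp only [hΦ, sub_self, norm_zero]
    have : 0 < (R ^ 2 - 0 ^ 2) ^ 2 := by norm_num; positivity
    positivity
  have hΦx : 0 < Φ x := hΦy.trans_le (hxmax hyB)
  have hxR : ‖x - y‖ ≤ R := by rwa [Metric.mem_closedBall, dist_eq_norm] at hxB
  have hη0 : 0 ≤ R ^ 2 - ‖x - y‖ ^ 2 := by nlinarith [norm_nonneg (x - y)]
  -- Φ(x) ≥ Φ(y) > 0 forces the maximum into the open ball, at a point where Du ≠ 0.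
  have hη : 0 < R ^ 2 - ‖x - y‖ ^ 2 := by
    refine lt_of_le_of_ne hη0 fun h => ?_
    simp [hΦ, ← h] at hΦx
  have hw : 0 < ‖fderiv ℝ u x‖ ^ 2 := by
    refine lt_of_le_of_ne (sq_nonneg _) fun h => ?_
    simp [hΦ, ← h] at hΦx
  have hxlt : ‖x - y‖ < R := by
    refine lt_of_le_of_ne hxR fun h => ?_
    rw [h, sub_self] at hη
    exact hη.false
  have hloc : IsLocalMax Φ x := hxmax.isLocalMax <| Filter.mem_of_superset
    (Metric.isOpen_ball.mem_nhds (by rwa [Metric.mem_ball, dist_eq_norm]))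
    Metric.ball_subset_closedBall
  obtain ⟨b, l, I, hI, hb, hl0, hl, hnn⟩ :=
    exists_eigenbasis hp (hu.of_le (by norm_num)) hpsh x (hsol x)
  have hux := abs_le.mp (hbd x hxB)
  have hcond := bernstein_conditions hu hb hη hw hloc
  set η := R ^ 2 - ‖x - y‖ ^ 2 with hηdef
  set w := ‖fderiv ℝ u x‖ ^ 2
  have hT : ∑ i ∈ I, ∑ j, 2 * fderiv ℝ u x (b j) *
      fderiv ℝ (fderiv ℝ (fderiv ℝ u)) x (b i) (b i) (b j) = 0 := by
    rw [Finset.sum_comm]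
    refine Finset.sum_eq_zero fun j _ => ?_
    simp_rw [thirdFDeriv_rotate hu]
    rw [← Finset.mul_sum, sum_thirdFDeriv_eq_zero hu I b x _ hnn, mul_zero]
    simpa [hb] using hl0
  have hQ : ∑ i, (-2 * ⟪x - y, b i⟫ / η) ^ 2 ≤ 4 * R ^ 2 / η ^ 2 := by
    have h : ∀ i, (-2 * ⟪x - y, b i⟫ / η) ^ 2 = 4 / η ^ 2 * ⟪x - y, b i⟫ ^ 2 := fun i => by
      rw [div_pow, mul_pow, mul_div_right_comm]
      norm_num
    have hs : ∑ i, ⟪x - y, b i⟫ ^ 2 = ‖x - y‖ ^ 2 := by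
      simpa using b.sum_sq_norm_inner_left (x - y)
    simp_rw [h]
    rw [← Finset.mul_sum, hs, div_mul_eq_mul_div]
    gcongr
  have hc : 1 / (72 * M) ≤ k * (u x + 2 * M) := by
    calc 1 / (72 * M) = k * M := by rw [hk]; field_simp
      _ ≤ _ := by gcongr; linarith
  have hc0 : 0 < k * (u x + 2 * M) := lt_of_lt_of_le (by positivity) hc
  have hkM : k * (u x + 2 * M) ^ 2 ≤ 1 / 8 := by
    calc k * (u x + 2 * M) ^ 2 ≤ k * (3 * M) ^ 2 := by gcongr <;> linarith
      _ = 1 / 8 := by rw [hk]; field_simp; norm_num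
  have hcd : 8 * (k * (u x + 2 * M)) ^ 2 ≤ k := by
    have : 8 * (k * (u x + 2 * M)) ^ 2 = k * (8 * (k * (u x + 2 * M) ^ 2)) := by ring
    rw [this]
    nlinarith
  have hbound := cutoff_sq_mul_sum_sq_le hη hw hc0 hk0 hcd (norm_sq_eq_sum_apply_sq b _).symm
    hl0 hl hT hQ (fun i => (hcond i).1) (fun i _ => (hcond i).2)
  have hηR : η ≤ R ^ 2 := by rw [hηdef]; nlinarith [sq_nonneg ‖x - y‖]
  -- 41472 = 8·72², 47232 = 41472 + 72·80 and 576 = 72·8.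
  have hmain : η ^ 2 * w ≤ (47232 + 576 * p) * (R ^ 2 * M ^ 2) := by
    have h1 : 2 * (4 * R ^ 2 / η ^ 2) / (k * (u x + 2 * M)) ^ 2 ≤
        2 * (4 * R ^ 2 / η ^ 2) / (1 / (72 * M)) ^ 2 := by gcongr
    calc η ^ 2 * w ≤ η ^ 2 * (2 * (4 * R ^ 2 / η ^ 2) / (1 / (72 * M)) ^ 2 +
          (8 * I.card / η + 20 * (4 * R ^ 2 / η ^ 2)) / k) := by gcongr; linarith
      _ = 41472 * (R ^ 2 * M ^ 2) + 72 * M ^ 2 * (8 * p * η + 80 * R ^ 2) := by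
          rw [hI, hk]
          field_simp
          ring
      _ ≤ 41472 * (R ^ 2 * M ^ 2) + 72 * M ^ 2 * (8 * p * R ^ 2 + 80 * R ^ 2) := by gcongr
      _ = _ := by ring
  have hexp : Real.exp (k * (u x + 2 * M) ^ 2) ≤ 3 :=
    (Real.exp_le_exp.mpr (hkM.trans (by norm_num))).trans Real.exp_one_lt_three.le
  have hfin : R ^ 4 * ‖fderiv ℝ u y‖ ^ 2 ≤ (47232 + 576 * p) * (R ^ 2 * M ^ 2) * 3 := by
    calc R ^ 4 * ‖fderiv ℝ u y‖ ^ 2 ≤ Φ y := by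
          simp only [hΦ, sub_self, norm_zero]
          have : 1 ≤ Real.exp (k * (u y + 2 * M) ^ 2) := Real.one_le_exp (by positivity)
          calc R ^ 4 * ‖fderiv ℝ u y‖ ^ 2 = (R ^ 2 - 0 ^ 2) ^ 2 * ‖fderiv ℝ u y‖ ^ 2 * 1 := by ring
            _ ≤ _ := by gcongr
      _ ≤ Φ x := hxmax hyB
      _ ≤ _ := by
          simp only [hΦ]
          gcongr
  have : ‖fderiv ℝ u y‖ ^ 2 ≤ (47232 + 576 * p) * (R ^ 2 * M ^ 2) * 3 / R ^ 4 := by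
    rw [le_div_iff₀ (by positivity)]
    linarith
  refine this.trans (le_of_eq ?_)
  field_simp

/-- A function of growth `o(‖x‖)` is at most `2εR` on every ball of large radius `R`. -/
theorem exists_radius_abs_le (hu : Continuous u)
    (ho : u =o[Bornology.cobounded (EuclideanSpace ℝ (Fin n))] fun x => ‖x‖)
    (y : EuclideanSpace ℝ (Fin n)) {ε : ℝ} (hε : 0 < ε) :
    ∃ R > 0, ∀ x ∈ Metric.closedBall y R, |u x| ≤ 2 * ε * R := by
  obtain ⟨r, -, hr⟩ := (Metric.hasBasis_cobounded_compl_closedBall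
    (0 : EuclideanSpace ℝ (Fin n))).eventually_iff.mp (ho.def hε)
  obtain ⟨K, hK⟩ := (isCompact_closedBall (0 : EuclideanSpace ℝ (Fin n))
    r).exists_bound_of_continuousOn hu.continuousOn
  -- R ≥ ‖y‖ gives ‖x‖ ≤ 2R on the ball; R ≥ K/(2ε) covers the compact set where the growth bound
  -- may fail.
  refine ⟨max 1 (max ‖y‖ (K / (2 * ε))), by positivity, fun x hx => ?_⟩
  set R := max 1 (max ‖y‖ (K / (2 * ε)))
  have hRy : ‖y‖ ≤ R := (le_max_left _ _).trans (le_max_right _ _)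
  have hRK : K ≤ 2 * ε * R := by
    have : K / (2 * ε) ≤ R := (le_max_right _ _).trans (le_max_right _ _)
    rwa [div_le_iff₀' (by positivity)] at this
  by_cases hxr : x ∈ Metric.closedBall 0 r
  · exact (hK x hxr).trans hRK
  · have h1 := hr hxr
    have h2 : ‖x‖ ≤ 2 * R := by
      have := norm_le_norm_add_norm_sub' x y
      rw [Metric.mem_closedBall, dist_eq_norm] at hx
      linarith
    rw [norm_norm, Real.norm_eq_abs] at h1
    nlinarith

end

end PPsh

/-! ### The Liouville theorem. -/

theorem mainTheorem5 (n p : ℕ) (hp : 1 < p) (hpn : p < n)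
    (u : EuclideanSpace ℝ (Fin n) → ℝ) (hu : ContDiff ℝ 3 u)
    (hpsh : PPsh.IsPPlurisubharmonic p u)
    (hsol : ∀ x, PPsh.pMongeAmpere p u (hu.of_le (by norm_num)) x = 0)
    (hgrowth : (∃ C : ℝ, ∀ x, |u x| ≤ C) ∨
      u =o[Bornology.cobounded (EuclideanSpace ℝ (Fin n))] fun x => ‖x‖) :
    ∃ c : ℝ, ∀ x, u x = c := by
  have ho : u =o[Bornology.cobounded (EuclideanSpace ℝ (Fin n))] fun x => ‖x‖ := by
    rcases hgrowth with ⟨C, hC⟩ | ho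
    · have h1 : u =O[Bornology.cobounded (EuclideanSpace ℝ (Fin n))] fun _ => (1 : ℝ) :=
        .of_bound C (Eventually.of_forall fun x => by simpa using hC x)
      refine h1.trans_isLittleO ((isLittleO_const_left (c := (1 : ℝ))).mpr (Or.inr ?_))
      simpa [Function.comp_def] using
        tendsto_norm_cobounded_atTop (E := EuclideanSpace ℝ (Fin n))
    · exact ho
  have hzero : ∀ y, fderiv ℝ u y = 0 := fun y => by
    have hle : ∀ ε : ℝ, 0 < ε →
        ‖fderiv ℝ u y‖ ^ 2 ≤ 3 * (47232 + 576 * p) * (2 * ε) ^ 2 := fun ε hε => by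
      obtain ⟨R, hR, hbd⟩ := PPsh.exists_radius_abs_le hu.continuous ho y hε
      -- Here M = 2εR, so the radius cancels from M/R.
      have := PPsh.norm_fderiv_sq_le (by omega) hu hpsh hsol y hR (by positivity) hbd
      rwa [mul_div_assoc, div_self hR.ne', mul_one] at this
    have hlim : Tendsto (fun ε : ℝ => 3 * (47232 + 576 * (p : ℝ)) * (2 * ε) ^ 2) (𝓝[>] 0)
        (𝓝 0) := by
      have : Continuous fun ε : ℝ => 3 * (47232 + 576 * (p : ℝ)) * (2 * ε) ^ 2 := by fun_prop
      simpa using (this.tendsto 0).mono_left nhdsWithin_le_nhds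
    have h0 : ‖fderiv ℝ u y‖ ^ 2 ≤ 0 := ge_of_tendsto hlim
      (eventually_nhdsWithin_of_forall hle)
    simpa using le_antisymm h0 (sq_nonneg _)
  exact ⟨u 0, fun x => is_const_of_fderiv_eq_zero (hu.differentiable (by norm_num)) hzero x 0⟩
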